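/- Let $\mathbb K$ be the $C^*$-algebra of compact operators on $\ell^2(\mathbb N)$ and let $M(\cdot)$ denote the multiplier algebra. A subset of a $C^*$-algebra $B$ is called full in $B$ if it is contained in no proper closed two-sided ideal of $B$; an element is full if the singleton containing it is. An extension $0\to B\to E\to A\to 0$ of $C^*$-algebras with $B$ stable (i.e. $B\cong B\otimes\mathbb K$) is called purely large if for every $x\in E\setminus B$ the hereditary $C^*$-subalgebra $\overline{xBx^*}$ of $B$ contains a stable, $\sigma$-unital $C^*$-subalgebra $D$ that is full in $B$; it is called non-unital if $E$ has no unit. Its unitisation is the extension $0\to B\to E^\dagger\to A^\dagger\to 0$ obtained by adjoining a unit to both $E$ and $A$. The trivial extension of $A$ by $B$ with splitting a $*$-homomorphism $\sigma\colon A\to M(B)$ has extension algebra $E=\{(a,m)\in A\oplus M(B) : m-\sigma(a)\in B\}$, inclusion $b\mapsto(0,b)$ and quotient map $(a,m)\mapsto a$. **Lemma.** There exists a non-unital purely large extension whose unitisation is not purely large. More precisely: the $C^*$-algebra $\mathbb K\oplus\mathbb K$ is stable; there is a full projection $P\in M(\mathbb K)$ such that $1-P$ is also full; and for every such $P$, the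 trivial extension of $\mathbb C$ by $\mathbb K\oplus\mathbb K$ with splitting $\sigma\colon\mathbb C\to M(\mathbb K)\oplus M(\mathbb K)\cong M(\mathbb K\oplus\mathbb K)$ given by $\sigma(1)=P\oplus 1$ is non-unital and purely large, whereas its unitisation is not purely large. -/

import Mathlib

open Filter Topology
open scoped MultiplierAlgebra

noncomputable section

namespace PurelyLargeExt

/-! ### Stability, σ-unitality, fullness -/

/-- The corner embedding `M_n(D) → M_{n+1}(D)`, `a ↦ diag(a, 0)`. -/
def corner {D : Type*} [Zero D] {n : ℕ} (a : CStarMatrix (Fin n) (Fin n) D) :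
    CStarMatrix (Fin (n + 1)) (Fin (n + 1)) D :=
  CStarMatrix.ofMatrix fun i j =>
    if h : (i : ℕ) < n ∧ (j : ℕ) < n then a ⟨i, h.1⟩ ⟨j, h.2⟩ else 0

/-- `C` is (a copy of) the stabilisation `D ⊗ 𝕂`, that is, of the C⋆-algebraic inductive limit of
`M_1(D) ⊆ M_2(D) ⊆ M_3(D) ⊆ ⋯` along the corner embeddings: there are compatible injective
(hence isometric) ⋆-homomorphisms `M_n(D) → C` whose ranges have dense union. -/
def IsStabilisation (D C : Type*) [NonUnitalCStarAlgebra D] [NonUnitalCStarAlgebra C] : Prop :=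
  ∃ φ : ∀ n : ℕ, CStarMatrix (Fin n) (Fin n) D →⋆ₙₐ[ℂ] C,
    (∀ n, Function.Injective (φ n)) ∧
    (∀ n a, φ (n + 1) (corner a) = φ n a) ∧
    Dense (⋃ n, Set.range (φ n))

/-- `D` is stable: `D ≅ D ⊗ 𝕂`. -/
def IsStable (D : Type*) [NonUnitalCStarAlgebra D] : Prop :=
  IsStabilisation D D

/-- `D` is σ-unital: it has a sequential approximate unit of positive contractions. -/
def IsSigmaUnital (D : Type*) [NonUnitalCStarAlgebra D] : Prop :=
  ∃ u : ℕ → D, (∀ n, ∃ c : D, u n = star c * c) ∧ (∀ n, ‖u n‖ ≤ 1) ∧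
    ∀ a : D, Tendsto (fun n => u n * a) atTop (𝓝 a) ∧ Tendsto (fun n => a * u n) atTop (𝓝 a)

/-- `S` is (norm-)full in `B`: it is contained in no proper closed two-sided ideal of `B`. -/
def IsFull {B : Type*} [NonUnitalCStarAlgebra B] (S : Set B) : Prop :=
  ∀ I : TwoSidedIdeal B, IsClosed (I : Set B) → S ⊆ (I : Set B) → ∀ b : B, b ∈ I

/-! ### Extensions of C⋆-algebras -/

/-- An extension `0 → B → E → A → 0` of C⋆-algebras. -/
structure CStarExtension (B E A : Type*) [NonUnitalCStarAlgebra B] [NonUnitalCStarAlgebra E]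
    [NonUnitalCStarAlgebra A] where
  /-- the inclusion of the ideal -/
  incl : B →⋆ₙₐ[ℂ] E
  /-- the quotient map -/
  quot : E →⋆ₙₐ[ℂ] A
  incl_injective : Function.Injective incl
  quot_surjective : Function.Surjective quot
  exact : ∀ x : E, quot x = 0 ↔ x ∈ Set.range incl

namespace CStarExtension

variable {B E A : Type*} [NonUnitalCStarAlgebra B] [NonUnitalCStarAlgebra E]
  [NonUnitalCStarAlgebra A]

/-- The hereditary C⋆-subalgebra `closure (x B x*)` of `B`, for `x : E`. -/
def hereditary (e : CStarExtension B E A) (x : E) : Set B :=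
  closure {d : B | ∃ b : B, e.incl d = x * e.incl b * star x}

/-- The extension is purely large: for every `x ∈ E \ B` the hereditary C⋆-subalgebra
`closure (x B x*)` of `B` contains a stable, σ-unital C⋆-subalgebra `D` that is full in `B`.
(The notion is meant for stable `B`.) -/
def IsPurelyLarge (e : CStarExtension B E A) : Prop :=
  ∀ x : E, x ∉ Set.range e.incl →
    ∃ (D : NonUnitalStarSubalgebra ℂ B) (_ : IsClosed (D : Set B)),
      (D : Set B) ⊆ e.hereditary x ∧ IsStable D ∧ IsSigmaUnital D ∧ IsFull (D : Set B)

/-- The unitised extension `0 → B → E† → A† → 0`, a unit being adjoined to both `E` and `A`. -/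
def unitisation (e : CStarExtension B E A) :
    CStarExtension B (Unitization ℂ E) (Unitization ℂ A) where
  incl := (Unitization.inrNonUnitalStarAlgHom ℂ E).comp e.incl
  quot := (Unitization.starMap e.quot : Unitization ℂ E →⋆ₐ[ℂ] Unitization ℂ A)
  incl_injective := fun a b h => e.incl_injective (Unitization.inr_injective h)
  quot_surjective := Unitization.starMap_surjective e.quot_surjective
  exact := by
    intro x
    induction x using Unitization.ind with
    | inl_add_inr r y =>
      constructor
      · intro h
        have h' : (Unitization.starMap e.quot) (Unitization.inl r + (y : Unitization ℂ E)) = 0 := h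
        rw [map_add, Unitization.starMap_inl, Unitization.starMap_inr,
          Unitization.algebraMap_eq_inl] at h'
        have h1 : r = 0 := by simpa using congrArg (fun z : Unitization ℂ A => z.fst) h'
        have h2 : e.quot y = 0 := by simpa using congrArg (fun z : Unitization ℂ A => z.snd) h'
        obtain ⟨b, hb⟩ := (e.exact y).1 h2
        refine ⟨b, ?_⟩
        change ((e.incl b : E) : Unitization ℂ E) = _
        rw [hb, h1]
        simp
      · rintro ⟨b, hb⟩
        have hb' : ((e.incl b : E) : Unitization ℂ E) =
            Unitization.inl r + (y : Unitization ℂ E) := hb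
        rw [← hb']
        change Unitization.starMap e.quot ((e.incl b : E) : Unitization ℂ E) = 0
        rw [Unitization.starMap_inr, (e.exact _).2 ⟨b, rfl⟩]
        simp

end CStarExtension

/-! ### Trivial extensions -/

section Trivial

variable {A B : Type*} [NonUnitalCStarAlgebra A] [NonUnitalCStarAlgebra B]

theorem coe_injective : Function.Injective (DoubleCentralizer.coeHom (𝕜 := ℂ) (A := B)) := by
  rw [injective_iff_map_eq_zero]
  intro a ha
  have h : (DoubleCentralizer.coeHom (𝕜 := ℂ) (A := B) a).fst (star a) = 0 := by
    rw [ha]; rfl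
  have h' : a * star a = 0 := h
  exact CStarRing.mul_star_self_eq_zero_iff a |>.1 h'

theorem fst_mul (m : 𝓜(ℂ, B)) (c z : B) : m.fst (c * z) = m.fst c * z := by
  have h : ∀ x : B, x * (m.fst (c * z) - m.fst c * z) = 0 := fun x => by
    rw [mul_sub, ← m.central, ← mul_assoc x, ← m.central, mul_assoc, sub_self]
  exact sub_eq_zero.1 (CStarRing.star_mul_self_eq_zero_iff _ |>.1 (h _))

theorem snd_mul (m : 𝓜(ℂ, B)) (z b : B) : m.snd (z * b) = z * m.snd b := by
  have h : ∀ x : B, (m.snd (z * b) - z * m.snd b) * x = 0 := fun x => by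
    rw [sub_mul, m.central, mul_assoc, mul_assoc z, m.central, sub_self]
  exact sub_eq_zero.1 (CStarRing.mul_star_self_eq_zero_iff _ |>.1 (h _))

/-- The extension algebra of the trivial extension of `A` by `B` with splitting `σ : A → M(B)`:
the pullback `{(a, m) ∈ A ⊕ M(B) | m - σ a ∈ B}` of the quotient map `M(B) → M(B)/B` along the
Busby map `a ↦ σ a + B`. -/
def trivialAlg (σ : A →⋆ₙₐ[ℂ] 𝓜(ℂ, B)) : NonUnitalStarSubalgebra ℂ (A × 𝓜(ℂ, B)) where
  carrier := {x | ∃ b : B, x.2 - σ x.1 = DoubleCentralizer.coeHom (𝕜 := ℂ) b}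
  zero_mem' := ⟨0, by rw [map_zero]; simp⟩
  add_mem' := by
    rintro x y ⟨b, hb⟩ ⟨c, hc⟩
    refine ⟨b + c, ?_⟩
    rw [map_add, ← hb, ← hc]
    simp only [Prod.snd_add, Prod.fst_add, map_add]
    abel
  smul_mem' := by
    rintro z x ⟨b, hb⟩
    refine ⟨z • b, ?_⟩
    rw [map_smul, ← hb]
    simp [smul_sub]
  star_mem' := by
    rintro x ⟨b, hb⟩
    refine ⟨star b, ?_⟩
    rw [map_star, ← hb]
    simp [map_star]
  mul_mem' := by
    rintro x y ⟨b, hb⟩ ⟨c, hc⟩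
    refine ⟨b * c + (σ x.1).fst c + (σ y.1).snd b, ?_⟩
    have h1 : σ x.1 * DoubleCentralizer.coeHom (𝕜 := ℂ) c
        = DoubleCentralizer.coeHom (𝕜 := ℂ) ((σ x.1).fst c) := by
      ext z
      · exact fst_mul (σ x.1) c z
      · exact (σ x.1).central z c
    have h2 : DoubleCentralizer.coeHom (𝕜 := ℂ) b * σ y.1
        = DoubleCentralizer.coeHom (𝕜 := ℂ) ((σ y.1).snd b) := by
      ext z
      · exact ((σ y.1).central b z).symm
      · exact snd_mul (σ y.1) z b
    rw [map_add, map_add, map_mul, ← h1, ← h2, ← hb, ← hc]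
    simp only [Prod.snd_mul, Prod.fst_mul, map_mul]
    noncomm_ring

theorem isClosed_trivialAlg (σ : A →⋆ₙₐ[ℂ] 𝓜(ℂ, B)) :
    IsClosed (trivialAlg σ : Set (A × 𝓜(ℂ, B))) := by
  have h : IsClosed (Set.range (DoubleCentralizer.coeHom (𝕜 := ℂ) (A := B))) :=
    (NonUnitalStarAlgHom.isometry _ coe_injective).isClosedEmbedding.isClosed_range
  have hσ : Continuous σ :=
    AddMonoidHomClass.continuous_of_bound σ 1 fun a => by
      simpa using NonUnitalStarAlgHom.norm_apply_le σ a
  have hc : Continuous fun x : A × 𝓜(ℂ, B) => x.2 - σ x.1 :=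
    continuous_snd.sub (hσ.comp continuous_fst)
  have : (trivialAlg σ : Set (A × 𝓜(ℂ, B))) =
      (fun x : A × 𝓜(ℂ, B) => x.2 - σ x.1) ⁻¹'
        Set.range (DoubleCentralizer.coeHom (𝕜 := ℂ) (A := B)) := by
    ext x
    exact ⟨fun ⟨b, hb⟩ => ⟨b, hb.symm⟩, fun ⟨b, hb⟩ => ⟨b, hb.symm⟩⟩
  rw [this]
  exact h.preimage hc

instance (σ : A →⋆ₙₐ[ℂ] 𝓜(ℂ, B)) : IsClosed (trivialAlg σ : Set (A × 𝓜(ℂ, B))) :=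
  isClosed_trivialAlg σ

/-- The trivial extension `0 → B → E → A → 0` with splitting `σ : A → M(B)`; the inclusion is
`b ↦ (0, b)` and the quotient map is `(a, m) ↦ a`. -/
def trivialExtension (σ : A →⋆ₙₐ[ℂ] 𝓜(ℂ, B)) : CStarExtension B (trivialAlg σ) A where
  incl :=
    { toFun := fun b => ⟨(0, DoubleCentralizer.coeHom (𝕜 := ℂ) b), ⟨b, by simp⟩⟩
      map_smul' := fun z b => by ext1; exact Prod.ext (by simp) (map_smul _ _ _)
      map_zero' := by ext1; exact Prod.ext rfl (map_zero _)
      map_add' := fun a b => by ext1; exact Prod.ext (by simp) (map_add _ _ _)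
      map_mul' := fun a b => by ext1; exact Prod.ext (by simp) (map_mul _ _ _)
      map_star' := fun b => by ext1; exact Prod.ext (by simp) (map_star _ _) }
  quot :=
    { toFun := fun x => x.1.1
      map_smul' := fun _ _ => rfl
      map_zero' := rfl
      map_add' := fun _ _ => rfl
      map_mul' := fun _ _ => rfl
      map_star' := fun _ => rfl }
  incl_injective := fun a b h => coe_injective (congrArg (fun x => x.1.2) h)
  quot_surjective := fun a => ⟨⟨(a, σ a), ⟨0, by rw [map_zero]; simp⟩⟩, rfl⟩
  exact := by
    rintro ⟨⟨a, m⟩, b, hb⟩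
    constructor
    · intro h
      have ha : a = 0 := h
      subst ha
      refine ⟨b, ?_⟩
      ext1
      refine Prod.ext rfl ?_
      simpa using hb.symm
    · rintro ⟨c, hc⟩
      exact (congrArg (fun x => x.1.1) hc).symm

/-- The ⋆-homomorphism `a ↦ (a, σ a)` which splits the trivial extension. -/
def splitting (σ : A →⋆ₙₐ[ℂ] 𝓜(ℂ, B)) : A →⋆ₙₐ[ℂ] trivialAlg σ where
  toFun a := ⟨(a, σ a), ⟨0, by rw [map_zero]; simp⟩⟩
  map_smul' _ _ := by ext1; exact Prod.ext rfl (map_smul _ _ _)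
  map_zero' := by ext1; exact Prod.ext rfl (map_zero _)
  map_add' _ _ := by ext1; exact Prod.ext rfl (map_add _ _ _)
  map_mul' _ _ := by ext1; exact Prod.ext rfl (map_mul _ _ _)
  map_star' _ := by ext1; exact Prod.ext rfl (map_star _ _)

theorem quot_splitting (σ : A →⋆ₙₐ[ℂ] 𝓜(ℂ, B)) (a : A) :
    (trivialExtension σ).quot (splitting σ a) = a := rfl

end Trivial

/-! ### The multiplier algebra of a direct sum -/

section DirectSum

variable {B C : Type*} [NonUnitalCStarAlgebra B] [NonUnitalCStarAlgebra C]

/-- The multiplier `m ⊕ n ∈ M(B) ⊕ M(C) ≅ M(B ⊕ C)`, acting coordinatewise. -/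
def directSum (m : 𝓜(ℂ, B)) (n : 𝓜(ℂ, C)) : 𝓜(ℂ, B × C) where
  fst := m.fst.prodMap n.fst
  snd := m.snd.prodMap n.snd
  central x y := Prod.ext (m.central x.1 y.1) (n.central x.2 y.2)

end DirectSum

/-! ### The compact operators -/

section Compacts

variable {H : Type*} [NormedAddCommGroup H] [InnerProductSpace ℂ H] [CompleteSpace H]

theorem isCompactOperator_adjoint {T : H →L[ℂ] H} (hT : IsCompactOperator T) :
    IsCompactOperator (ContinuousLinearMap.adjoint T) := by
  set S := ContinuousLinearMap.adjoint T with hS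
  have hTS : IsCompactOperator (T.comp S) := hT.comp_clm S
  obtain ⟨K, hK, hKsub⟩ := hTS.image_ball_subset_compact 1
  have htb : TotallyBounded ((T.comp S) '' Metric.ball 0 1) := hK.totallyBounded.subset hKsub
  have htb' : TotallyBounded (S '' Metric.ball 0 1) := by
    rw [Metric.totallyBounded_iff]
    intro ε hε
    obtain ⟨t, htsub, htfin, ht⟩ :=
      Metric.finite_approx_of_totallyBounded htb (ε ^ 2 / 2) (by positivity)
    choose! g hg using fun y (hy : y ∈ t) => htsub hy
    refine ⟨(fun y => S (g y)) '' t, htfin.image _, ?_⟩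
    rintro _ ⟨x, hx, rfl⟩
    obtain ⟨y, hy, hxy⟩ := Set.mem_iUnion₂.1 (ht ⟨x, hx, rfl⟩)
    refine Set.mem_iUnion₂.2 ⟨S (g y), ⟨y, hy, rfl⟩, ?_⟩
    rw [← (hg y hy).2, Metric.mem_ball, dist_eq_norm, ← map_sub] at hxy
    rw [Metric.mem_ball, dist_eq_norm, ← map_sub]
    have hb : ‖x - g y‖ ≤ 2 := by
      have h1 : ‖x‖ < 1 := by simpa using hx
      have h2 : ‖g y‖ < 1 := by simpa using (hg y hy).1
      linarith [norm_sub_le x (g y)]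
    have hsq : ‖S (x - g y)‖ ^ 2 ≤ ‖(T.comp S) (x - g y)‖ * ‖x - g y‖ := by
      have h1 : inner ℂ (S (x - g y)) (S (x - g y)) = inner ℂ (T (S (x - g y))) (x - g y) :=
        ContinuousLinearMap.adjoint_inner_right T _ _
      have h2 : ‖inner ℂ (S (x - g y)) (S (x - g y))‖ = ‖S (x - g y)‖ ^ 2 := by
        rw [inner_self_eq_norm_sq_to_K]
        simp
      rw [← h2, h1]
      exact norm_inner_le_norm _ _
    have hlt : ‖S (x - g y)‖ ^ 2 < ε ^ 2 := by
      nlinarith [norm_nonneg ((T.comp S) (x - g y)), norm_nonneg (x - g y)]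
    exact lt_of_pow_lt_pow_left₀ 2 hε.le hlt
  refine (isCompactOperator_iff_isCompact_closure_image_ball (S : H →ₗ[ℂ] H) one_pos).2 ?_
  exact htb'.closure.isCompact_of_isClosed isClosed_closure

variable (H) in
/-- The C⋆-algebra of compact operators on the Hilbert space `H`. -/
def compacts : NonUnitalStarSubalgebra ℂ (H →L[ℂ] H) where
  carrier := {T | IsCompactOperator T}
  zero_mem' := isCompactOperator_zero
  add_mem' := fun hS hT => hS.add hT
  smul_mem' := fun c _ hT => hT.smul c
  mul_mem' := fun {S} _ _ hT => hT.clm_comp S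
  star_mem' := fun hT => isCompactOperator_adjoint hT

instance : IsClosed (compacts H : Set (H →L[ℂ] H)) :=
  isClosed_setOfPred_isCompactOperator

end Compacts

/-- `𝕂`, the C⋆-algebra of compact operators on `ℓ²(ℕ)`. -/
abbrev 𝕂 : Type := compacts (lp (fun _ : ℕ => ℂ) 2)

end PurelyLargeExt
end

/-!
The multiplier algebra of `𝕂` is the algebra of all bounded operators on `ℓ²(ℕ)`
(`ofOperator_surjective`), and a full multiplier cannot lie in `𝕂`, because `𝕂` is a closed ideal of
its multiplier algebra and contains no unit (`IsFull.notMem_range_coeHom`,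
`one_notMem_range_coeHom`). If `P` and `1 - P` are full, this gives the two assertions about the
extension itself.

* *No unit.* A unit of the extension algebra has scalar part `1` and multiplier part `1`, which
  forces `1 - P ∈ 𝕂` (`not_exists_unit_trivialAlg`).
* *Purely large.* An element outside `𝕂 ⊕ 𝕂` has multiplier part `(z P + b) ⊕ (z + c)` with `z ≠ 0`
  and `b, c ∈ 𝕂`, so that both components are non-compact operators `L` and `N`. The range of a
  non-compact operator contains an infinite orthonormal sequence. The isometry `V` that maps the
  standard basis to such a sequence for `L` satisfies `V 𝕂 V⋆ ⊆ closure (L 𝕂 L⋆)`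
  (`exists_isometry_tendsto_conj`). With an isometry `W` chosen likewise for `N`, the algebra
  `V 𝕂 V⋆ ⊕ W 𝕂 W⋆` is a copy of `𝕂 ⊕ 𝕂`, so it is stable and σ-unital, and it is full
  (`isFull_range_conjProd`).

In the unitisation, the element `1 - (1, P ⊕ 1)` acts on `𝕂 ⊕ 𝕂` as `(1 - P) ⊕ 0`. It is not in
`𝕂 ⊕ 𝕂`, but its hereditary subalgebra lies in the proper closed ideal `𝕂 ⊕ 0`
(`not_isPurelyLarge_unitisation`).

Stability of `𝕂 ⊕ 𝕂` and the existence of `P` both come from a sequence of isometries `shift i` with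
orthogonal ranges that span `ℓ²(ℕ)`: the former through `IsStable.of_isometries`, the latter by
taking for `P` the range projection of `shift 0`, whose complement dominates that of `shift 1`.
-/

namespace PurelyLargeExt

/-! ### A criterion for stability -/

theorem corner_apply {D : Type*} [Zero D] {n : ℕ} (a : CStarMatrix (Fin n) (Fin n) D)
    (i j : Fin (n + 1)) : corner a i j =
      if h : (i : ℕ) < n ∧ (j : ℕ) < n then a ⟨i, h.1⟩ ⟨j, h.2⟩ else 0 := rfl

theorem isStarProjection_sum_range {R : Type*} [Ring R] [StarRing R] {p : ℕ → R}
    (hstar : ∀ i, star (p i) = p i) (hmul : ∀ i j, p i * p j = if i = j then p i else 0) (n : ℕ) :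
    IsStarProjection (∑ i ∈ Finset.range n, p i) := by
  refine ⟨?_, ?_⟩
  · simp only [IsIdempotentElem, Finset.sum_mul, Finset.mul_sum, hmul]
    exact Finset.sum_congr rfl fun i hi => by simp [Finset.mem_range.1 hi]
  · simp [isSelfAdjoint_iff, hstar]

/-- If `S 0, S 1, …` are isometries with pairwise orthogonal ranges, then sums of their range
projections are projections. -/
theorem isStarProjection_sum_range_mul_star {R : Type*} [Ring R] [StarRing R] {S : ℕ → R}
    (hS : ∀ i j, star (S i) * S j = if i = j then 1 else 0) (n : ℕ) :
    IsStarProjection (∑ i ∈ Finset.range n, S i * star (S i)) := by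
  refine isStarProjection_sum_range (fun i => by simp) (fun i j => ?_) n
  rw [show S i * star (S i) * (S j * star (S j)) = S i * (star (S i) * S j) * star (S j) by
    noncomm_ring, hS]
  split_ifs with h <;> simp [h]

/-- Contractions that approximate `x` from the left and from the right do so from both sides
simultaneously. -/
theorem tendsto_mul_mul_of_norm_le_one {R : Type*} [NormedRing R] {Q : ℕ → R} {x : R}
    (hQ : ∀ n, ‖Q n‖ ≤ 1) (hl : Tendsto (fun n => Q n * x) atTop (𝓝 x))
    (hr : Tendsto (fun n => x * Q n) atTop (𝓝 x)) :
    Tendsto (fun n => Q n * x * Q n) atTop (𝓝 x) := by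
  rw [tendsto_iff_norm_sub_tendsto_zero] at hl hr ⊢
  have h0 := hl.add hr
  rw [add_zero] at h0
  refine squeeze_zero (fun _ => norm_nonneg _) (fun n => ?_) h0
  calc ‖Q n * x * Q n - x‖ = ‖(Q n * x - x) + Q n * (x * Q n - x)‖ := by
        congr 1
        noncomm_ring
    _ ≤ ‖Q n * x - x‖ + ‖Q n‖ * ‖x * Q n - x‖ :=
        (norm_add_le _ _).trans (by gcongr; exact norm_mul_le _ _)
    _ ≤ ‖Q n * x - x‖ + ‖x * Q n - x‖ := by
        gcongr
        exact mul_le_of_le_one_left (norm_nonneg _) (hQ n)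

/-- A C⋆-algebra `B` that sits as a left (hence two-sided) ideal in a unital C⋆-algebra `M` is
stable as soon as `M` contains isometries `S 0, S 1, …` with pairwise orthogonal ranges whose range
projections sum strictly to `1`: then `(a i j) ↦ ∑ S i * a i j * (S j)⋆` identifies the matrix
algebras over `B` with an increasing sequence of subalgebras of `B` with dense union. -/
theorem IsStable.of_isometries {B M : Type*} [NonUnitalCStarAlgebra B] [CStarAlgebra M]
    (ι : B →⋆ₙₐ[ℂ] M) (hι : Function.Injective ι) (hl : ∀ (m : M) (b : B), ∃ c, ι c = m * ι b)
    (S : ℕ → M) (hS : ∀ i j, star (S i) * S j = if i = j then 1 else 0)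
    (hR : ∀ b, Tendsto (fun n => (∑ i ∈ Finset.range n, S i * star (S i)) * ι b) atTop (𝓝 (ι b))) :
    IsStable B := by
  have hr : ∀ (m : M) (b : B), ∃ c, ι c = ι b * m := fun m b => by
    obtain ⟨c, hc⟩ := hl (star m) (star b)
    exact ⟨star c, by rw [map_star, hc, map_star, star_mul, star_star, star_star]⟩
  have hlr : ∀ (m m' : M) (b : B), ∃ c, ι c = m * ι b * m' := fun m m' b => by
    obtain ⟨c, hc⟩ := hl m b
    obtain ⟨d, hd⟩ := hr m' c
    exact ⟨d, by rw [hd, hc]⟩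
  choose f hf using fun i j => hlr (S i) (star (S j))
  have hsum : ∀ (n : ℕ) (a : CStarMatrix (Fin n) (Fin n) B),
      ι (∑ i : Fin n, ∑ j : Fin n, f i j (a i j)) =
        ∑ i : Fin n, ∑ j : Fin n, S i * ι (a i j) * star (S j) :=
    fun n a => by
    simp only [map_sum, hf]
  -- compressing by `S k` and `S l` recovers the entries
  have hentry : ∀ (n : ℕ) (a : CStarMatrix (Fin n) (Fin n) B) (k l : Fin n),
      star (S k) * (∑ i : Fin n, ∑ j : Fin n, S i * ι (a i j) * star (S j)) * S l = ι (a k l) :=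
    fun n a k l => by
    have h1 : ∀ i j : Fin n, star (S k) * (S i * ι (a i j) * star (S j)) * S l
        = if k = i then (if j = l then ι (a i j) else 0) else 0 := fun i j => by
      rw [show star (S k) * (S i * ι (a i j) * star (S j)) * S l
        = star (S k) * S i * ι (a i j) * (star (S j) * S l) by noncomm_ring, hS, hS]
      simp only [Fin.val_inj]
      split_ifs <;> simp
    simp [Finset.mul_sum, Finset.sum_mul, h1]
  let φ : ∀ n : ℕ, CStarMatrix (Fin n) (Fin n) B →⋆ₙₐ[ℂ] B := fun n =>
    { toFun := fun a => ∑ i : Fin n, ∑ j : Fin n, f i j (a i j)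
      map_smul' := fun z a => hι <| by
        rw [hsum, map_smul, hsum]
        simp [Finset.smul_sum]
      map_zero' := hι <| by
        rw [hsum]
        simp
      map_add' := fun a b => hι <| by
        rw [hsum, map_add, hsum, hsum]
        simp [mul_add, add_mul, Finset.sum_add_distrib]
      map_mul' := fun a b => hι <| by
        rw [hsum, map_mul, hsum, hsum]
        have h1 : ∀ i k l j : Fin n, S i * ι (a i k) * star (S k) * (S l * ι (b l j) * star (S j))
            = if k = l then S i * (ι (a i k) * ι (b l j)) * star (S j) else 0 := fun i k l j => by
          rw [show S i * ι (a i k) * star (S k) * (S l * ι (b l j) * star (S j))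
            = S i * ι (a i k) * (star (S k) * S l) * ι (b l j) * star (S j) by noncomm_ring, hS]
          simp only [Fin.val_inj]
          split_ifs <;> simp [mul_assoc]
        simp_rw [Finset.sum_mul_sum, CStarMatrix.mul_apply, map_sum, map_mul, Finset.mul_sum,
          Finset.sum_mul]
        refine Finset.sum_congr rfl fun i _ => ?_
        rw [Finset.sum_comm]
        refine Finset.sum_congr rfl fun l _ => ?_
        rw [Finset.sum_comm]
        simp [h1]
      map_star' := fun a => hι <| by
        rw [hsum, map_star, hsum]
        simp only [star_sum, star_mul, star_star, CStarMatrix.star_apply, map_star, mul_assoc]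
        exact Finset.sum_comm }
  have hφ : ∀ n a, ι (φ n a) = ∑ i : Fin n, ∑ j : Fin n, S i * ι (a i j) * star (S j) := hsum
  refine ⟨φ, fun n => ?_, fun n a => hι ?_, fun b => ?_⟩
  · refine (injective_iff_map_eq_zero _).2 fun a ha => ?_
    ext k l
    apply hι
    rw [← hentry n a k l, ← hφ, ha]
    simp
  · have h1 : ∀ i j : Fin n, corner a i.castSucc j.castSucc = a i j := fun i j => by
      simp [corner_apply]
    have h2 : ∀ i : Fin (n + 1), corner a i (Fin.last n) = 0 := fun i => by
      simp [corner_apply]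
    have h3 : ∀ j : Fin (n + 1), corner a (Fin.last n) j = 0 := fun i => by
      simp [corner_apply]
    rw [hφ, hφ]
    simp [Fin.sum_univ_castSucc, h1, h2, h3]
  · set R : ℕ → M := fun n => ∑ i ∈ Finset.range n, S i * star (S i) with hRdef
    have hRproj : ∀ n, IsStarProjection (R n) := isStarProjection_sum_range_mul_star hS
    have hRstar : ∀ n, star (R n) = R n := fun n => (hRproj n).isSelfAdjoint
    have hR' : Tendsto (fun n => ι b * R n) atTop (𝓝 (ι b)) := by
      have := (hR (star b)).star
      have h1 : ∀ n, star (∑ i ∈ Finset.range n, S i * star (S i)) = R n := hRstar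
      simpa only [star_mul, ← map_star, star_star, h1] using this
    -- `R n * b * R n` lies in the image of the `n × n` matrices and tends to `b`
    have hlim : Tendsto (fun n => R n * ι b * R n) atTop (𝓝 (ι b)) :=
      tendsto_mul_mul_of_norm_le_one (fun n => (hRproj n).norm_le) (hR b) hR'
    choose g hg using fun i j => hlr (star (S i)) (S j) b
    have hval' : ∀ (n : ℕ) (i j : Fin n), ι (CStarMatrix.ofMatrix (fun i j : Fin n => g i j) i j)
        = star (S i) * ι b * S j := fun n i j => hg i j
    have hval : ∀ n, ι (φ n (CStarMatrix.ofMatrix fun i j : Fin n => g i j)) = R n * ι b * R n :=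
      fun n => by
      rw [hφ]
      simp only [hval', hRdef, Finset.sum_range, Finset.sum_mul,
        Finset.mul_sum, mul_assoc]
      exact Finset.sum_comm
    have hb : Tendsto (fun n => φ n (CStarMatrix.ofMatrix fun i j : Fin n => g i j)) atTop
        (𝓝 b) := by
      rw [(NonUnitalStarAlgHom.isometry ι hι).isEmbedding.tendsto_nhds_iff]
      exact hlim.congr fun n => (hval n).symm
    exact mem_closure_of_tendsto hb
      (Eventually.of_forall fun n => Set.mem_iUnion.2 ⟨n, Set.mem_range_self _⟩)

theorem IsStable.of_starAlgEquiv {C D : Type*} [NonUnitalCStarAlgebra C] [NonUnitalCStarAlgebra D]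
    (f : C ≃⋆ₐ[ℂ] D) (h : IsStable C) : IsStable D := by
  obtain ⟨φ, hinj, hcorner, hdense⟩ := h
  let f' : C →⋆ₙₐ[ℂ] D := f
  let g' : D →⋆ₙₐ[ℂ] C := f.symm
  have hf : Continuous f' := (NonUnitalStarAlgHom.isometry f' f.injective).continuous
  refine ⟨fun n => f'.comp ((φ n).comp (CStarMatrix.mapₙₐ g')), fun n => ?_, fun n a => ?_, ?_⟩
  · refine f.injective.comp ((hinj n).comp fun a b hab => ?_)
    ext i j
    exact f.symm.injective (congrFun (congrFun hab i) j)
  · change f' (φ _ _) = f' (φ _ _)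
    rw [← hcorner n]
    congr 2
    ext i j
    change g' (corner a i j) = corner (CStarMatrix.mapₙₐ g' a) i j
    simp only [corner_apply]
    split_ifs
    · rfl
    · exact map_zero _
  · refine (f.surjective.denseRange.dense_image hf hdense).mono ?_
    rintro _ ⟨c, hc, rfl⟩
    obtain ⟨n, a, rfl⟩ := Set.mem_iUnion.1 hc
    refine Set.mem_iUnion.2 ⟨n, CStarMatrix.mapₙₐ f' a, ?_⟩
    change f' (φ n _) = f' (φ n a)
    congr 2
    ext i j
    exact f.symm_apply_apply _

theorem IsSigmaUnital.of_starAlgEquiv {C D : Type*} [NonUnitalCStarAlgebra C]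
    [NonUnitalCStarAlgebra D] (f : C ≃⋆ₐ[ℂ] D) (h : IsSigmaUnital C) : IsSigmaUnital D := by
  obtain ⟨u, hpos, hnorm, hu⟩ := h
  have hiso : Isometry f := NonUnitalStarAlgHom.isometry (f : C →⋆ₙₐ[ℂ] D) f.injective
  refine ⟨fun n => f (u n), fun n => ?_, fun n => ?_, fun a => ?_⟩
  · obtain ⟨c, hc⟩ := hpos n
    exact ⟨f c, (congrArg f hc).trans (by rw [map_mul, map_star])⟩
  · rw [hiso.norm_map_of_map_zero (map_zero f)]
    exact hnorm n
  · obtain ⟨a, rfl⟩ := f.surjective a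
    constructor
    · exact ((hiso.continuous.tendsto _).comp (hu a).1).congr fun n => map_mul f _ _
    · exact ((hiso.continuous.tendsto _).comp (hu a).2).congr fun n => map_mul f _ _

/-! ### Strong convergence and compact operators -/

section Hilbert

variable {E : Type*} [NormedAddCommGroup E] [InnerProductSpace ℂ E]

/-- Contractions that converge pointwise to the identity on a total set do so everywhere. -/
theorem tendsto_apply_of_dense_span {Q : ℕ → E →L[ℂ] E} (hQ : ∀ n, ‖Q n‖ ≤ 1) {s : Set E}
    (hs : (Submodule.span ℂ s).topologicalClosure = ⊤)
    (h : ∀ x ∈ s, Tendsto (fun n => Q n x) atTop (𝓝 x)) (x : E) :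
    Tendsto (fun n => Q n x) atTop (𝓝 x) := by
  have hspan : ∀ y ∈ Submodule.span ℂ s, Tendsto (fun n => Q n y) atTop (𝓝 y) := fun y hy => by
    induction hy using Submodule.span_induction with
    | mem y hy => exact h y hy
    | zero => simp
    | add y z _ _ hy hz => simpa using hy.add hz
    | smul c y _ hy => simpa using hy.const_smul c
  have hx : x ∈ closure (Submodule.span ℂ s : Set E) := by
    rw [← Submodule.topologicalClosure_coe, hs]
    trivial
  rw [Metric.tendsto_atTop]
  intro ε hε
  obtain ⟨y, hy, hxy⟩ := Metric.mem_closure_iff.1 hx (ε / 3) (by positivity)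
  obtain ⟨N, hN⟩ := Metric.tendsto_atTop.1 (hspan y hy) (ε / 3) (by positivity)
  refine ⟨N, fun n hn => ?_⟩
  have h1 : dist (Q n x) (Q n y) ≤ dist x y := by
    rw [dist_eq_norm, dist_eq_norm, ← map_sub]
    exact (Q n).le_of_opNorm_le (hQ n) _ |>.trans_eq (one_mul _)
  calc dist (Q n x) x ≤ dist (Q n x) (Q n y) + dist (Q n y) y + dist y x := dist_triangle4 _ _ _ _
    _ < ε := by rw [dist_comm y x]; linarith [hN n hn]

/-- On a compact operator, pointwise convergence of contractions becomes convergence in norm,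
because the image of the unit ball is totally bounded. -/
theorem tendsto_mul_of_isCompactOperator {Q : ℕ → E →L[ℂ] E} (hQ : ∀ n, ‖Q n‖ ≤ 1)
    (h : ∀ x, Tendsto (fun n => Q n x) atTop (𝓝 x)) {T : E →L[ℂ] E} (hT : IsCompactOperator T) :
    Tendsto (fun n => Q n * T) atTop (𝓝 T) := by
  rw [Metric.tendsto_atTop]
  intro ε hε
  obtain ⟨K, hK, hKsub⟩ := hT.image_closedBall_subset_compact 1
  obtain ⟨t, htfin, ht⟩ := Metric.totallyBounded_iff.1 hK.totallyBounded (ε / 4) (by positivity)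
  have hev : ∀ᶠ n in atTop, ∀ y ∈ t, dist (Q n y) y < ε / 4 :=
    (htfin.eventually_all).2 fun y _ => (h y).eventually (Metric.ball_mem_nhds y (by positivity))
  obtain ⟨N, hN⟩ := eventually_atTop.1 hev
  refine ⟨N, fun n hn => ?_⟩
  rw [dist_eq_norm]
  refine lt_of_le_of_lt (ContinuousLinearMap.opNorm_le_of_unit_norm (C := 3 * (ε / 4))
    (by positivity) fun x hx => ?_) (by linarith)
  obtain ⟨y, hy, hxy⟩ := Set.mem_iUnion₂.1 (ht (hKsub ⟨x, by simp [hx], rfl⟩))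
  have hxy' : dist (T x) y < ε / 4 := hxy
  have h1 : dist (Q n (T x)) (Q n y) ≤ dist (T x) y := by
    rw [dist_eq_norm, dist_eq_norm, ← map_sub]
    exact (Q n).le_of_opNorm_le (hQ n) _ |>.trans_eq (one_mul _)
  change ‖Q n (T x) - T x‖ ≤ _
  rw [← dist_eq_norm]
  calc dist (Q n (T x)) (T x) ≤ dist (Q n (T x)) (Q n y) + dist (Q n y) y + dist y (T x) :=
        dist_triangle4 _ _ _ _
    _ ≤ _ := by rw [dist_comm y]; linarith [hN n hn y hy]

end Hilbert

/-! ### Operators on `ℓ²(ℕ)` -/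

/-- The Hilbert space `ℓ²(ℕ)`. -/
abbrev Ell2 : Type := lp (fun _ : ℕ => ℂ) 2

/-- The standard orthonormal basis of `ℓ²(ℕ)`. -/
noncomputable def stdBasis : HilbertBasis ℕ ℂ Ell2 := ⟨LinearIsometryEquiv.refl ℂ Ell2⟩

/-- The operator on `ℓ²(ℕ)` that maps the standard basis to a given orthonormal sequence. -/
noncomputable def isometryOf {v : ℕ → Ell2} (hv : Orthonormal ℂ v) : Ell2 →L[ℂ] Ell2 :=
  hv.orthogonalFamily.linearIsometry.toContinuousLinearMap

theorem isometryOf_apply {v : ℕ → Ell2} (hv : Orthonormal ℂ v) (k : ℕ) :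
    isometryOf hv (stdBasis k) = v k := by
  have h := hv.orthogonalFamily.linearIsometry_apply_single (i := k) (1 : ℂ)
  have h' : stdBasis k = lp.single 2 k (1 : ℂ) := (stdBasis.repr_symm_single k).symm
  rw [h']
  exact h.trans (one_smul ℂ (v k))

theorem star_isometryOf_mul_self {v : ℕ → Ell2} (hv : Orthonormal ℂ v) :
    star (isometryOf hv) * isometryOf hv = 1 :=
  (ContinuousLinearMap.norm_map_iff_adjoint_comp_self _).1
    hv.orthogonalFamily.linearIsometry.norm_map

theorem ext_stdBasis {T T' : Ell2 →L[ℂ] Ell2} (h : ∀ k, T (stdBasis k) = T' (stdBasis k)) :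
    T = T' := by
  refine ContinuousLinearMap.ext_on
    ((Submodule.dense_iff_topologicalClosure_eq_top).2 stdBasis.dense_span) ?_
  rintro _ ⟨k, rfl⟩
  exact h k

theorem star_isometryOf_mul_of_orthogonal {v w : ℕ → Ell2} (hv : Orthonormal ℂ v)
    (hw : Orthonormal ℂ w) (hvw : ∀ i j, inner ℂ (v i) (w j) = 0) :
    star (isometryOf hv) * isometryOf hw = 0 := by
  refine ext_stdBasis fun l => ?_
  rw [mul_apply_eq_comp, isometryOf_apply, zero_apply]
  refine stdBasis.repr.injective (lp.ext (funext fun k => ?_))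
  rw [stdBasis.repr_apply_apply, ContinuousLinearMap.star_eq_adjoint,
    ContinuousLinearMap.adjoint_inner_right, isometryOf_apply, hvw, map_zero]
  rfl

/-- The projection onto the span of the first `n` standard basis vectors. -/
noncomputable def cutoff (n : ℕ) : Ell2 →L[ℂ] Ell2 :=
  ∑ i ∈ Finset.range n, InnerProductSpace.rankOne ℂ (stdBasis i) (stdBasis i)

theorem isCompactOperator_rankOne (x y : Ell2) :
    IsCompactOperator (InnerProductSpace.rankOne ℂ x y) := by
  rw [InnerProductSpace.rankOne_def']
  exact (isCompactOperator_of_locallyCompactSpace_rng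
    (ContinuousLinearMap.toSpanSingleton ℂ x)).comp_clm _

theorem isCompactOperator_sum {s : Finset ℕ} {T : ℕ → Ell2 →L[ℂ] Ell2}
    (h : ∀ i ∈ s, IsCompactOperator (T i)) : IsCompactOperator (∑ i ∈ s, T i : Ell2 →L[ℂ] Ell2) :=
  sum_mem (S := compacts Ell2) h

theorem isCompactOperator_cutoff (n : ℕ) : IsCompactOperator (cutoff n) :=
  isCompactOperator_sum fun _ _ => isCompactOperator_rankOne _ _

theorem isStarProjection_cutoff (n : ℕ) : IsStarProjection (cutoff n) := by
  refine isStarProjection_sum_range (fun i => ?_) (fun i j => ?_) n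
  · simp [ContinuousLinearMap.star_eq_adjoint]
  · rw [ContinuousLinearMap.mul_def, InnerProductSpace.rankOne_comp_rankOne,
      orthonormal_iff_ite.1 stdBasis.orthonormal]
    split_ifs with h <;> simp [h]

theorem star_cutoff (n : ℕ) : star (cutoff n) = cutoff n :=
  (isStarProjection_cutoff n).isSelfAdjoint

theorem norm_cutoff_le (n : ℕ) : ‖cutoff n‖ ≤ 1 := (isStarProjection_cutoff n).norm_le

theorem tendsto_cutoff (x : Ell2) : Tendsto (fun n => cutoff n x) atTop (𝓝 x) := by
  have h := (stdBasis.hasSum_repr x).tendsto_sum_nat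
  refine h.congr fun n => ?_
  simp [cutoff, HilbertBasis.repr_apply_apply]

theorem tendsto_cutoff_mul {T : Ell2 →L[ℂ] Ell2} (hT : IsCompactOperator T) :
    Tendsto (fun n => cutoff n * T) atTop (𝓝 T) :=
  tendsto_mul_of_isCompactOperator norm_cutoff_le tendsto_cutoff hT

theorem tendsto_mul_cutoff {T : Ell2 →L[ℂ] Ell2} (hT : IsCompactOperator T) :
    Tendsto (fun n => T * cutoff n) atTop (𝓝 T) := by
  have h := (tendsto_cutoff_mul (isCompactOperator_adjoint hT)).star
  simp only [← ContinuousLinearMap.star_eq_adjoint, star_mul, star_star, star_cutoff] at h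
  exact h

theorem tendsto_cutoff_mul_mul_cutoff {T : Ell2 →L[ℂ] Ell2} (hT : IsCompactOperator T) :
    Tendsto (fun n => cutoff n * T * cutoff n) atTop (𝓝 T) :=
  tendsto_mul_mul_of_norm_le_one norm_cutoff_le (tendsto_cutoff_mul hT) (tendsto_mul_cutoff hT)

theorem orthonormal_pair (i : ℕ) : Orthonormal ℂ fun k => stdBasis (Nat.pair i k) :=
  stdBasis.orthonormal.comp _ fun _ _ h => (Nat.pair_eq_pair.1 h).2

/-- The `i`-th of a sequence of isometries of `ℓ²(ℕ)` with pairwise orthogonal ranges which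
together span `ℓ²(ℕ)`: it maps the `k`-th basis vector to the one numbered by the pair `(i, k)`. -/
noncomputable def shift (i : ℕ) : Ell2 →L[ℂ] Ell2 := isometryOf (orthonormal_pair i)

theorem shift_apply (i k : ℕ) : shift i (stdBasis k) = stdBasis (Nat.pair i k) :=
  isometryOf_apply _ _

theorem star_shift_mul_shift (i j : ℕ) : star (shift i) * shift j = if i = j then 1 else 0 := by
  split_ifs with h
  · subst h
    exact star_isometryOf_mul_self _
  · refine star_isometryOf_mul_of_orthogonal _ _ fun _ _ => ?_
    exact stdBasis.orthonormal.2 fun h' => h (Nat.pair_eq_pair.1 h').1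

theorem tendsto_sum_shift (x : Ell2) :
    Tendsto (fun n => (∑ i ∈ Finset.range n, shift i * star (shift i)) x) atTop (𝓝 x) := by
  refine tendsto_apply_of_dense_span (fun n => ?_) stdBasis.dense_span ?_ x
  · exact (isStarProjection_sum_range_mul_star star_shift_mul_shift n).norm_le
  · rintro _ ⟨m, rfl⟩
    refine tendsto_const_nhds.congr' ?_
    filter_upwards [eventually_gt_atTop (Nat.unpair m).1] with n hn
    have h1 : ∀ i, (shift i * star (shift i)) (stdBasis m)
        = if i = (Nat.unpair m).1 then stdBasis m else 0 := fun i => by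
      have h2 : stdBasis m = shift (Nat.unpair m).1 (stdBasis (Nat.unpair m).2) := by
        rw [shift_apply, Nat.pair_unpair]
      have h3 : star (shift i) (shift (Nat.unpair m).1 (stdBasis (Nat.unpair m).2)) =
        (star (shift i) * shift (Nat.unpair m).1) (stdBasis (Nat.unpair m).2) := rfl
      rw [h2, mul_apply_eq_comp, h3, star_shift_mul_shift]
      split_ifs with h
      · rw [h]; rfl
      · simp
    simp [h1, hn]

/-- A non-compact operator has infinite-dimensional range, so its range contains an infinite
orthonormal sequence. -/
theorem exists_orthonormal_of_not_isCompactOperator {L : Ell2 →L[ℂ] Ell2}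
    (hL : ¬ IsCompactOperator L) : ∃ f : ℕ → Ell2, Orthonormal ℂ fun k => L (f k) := by
  have hfin : ¬ FiniteDimensional ℂ L.range := fun hfin => hL <| by
    have := FiniteDimensional.proper ℂ L.range
    have h1 : IsCompactOperator (L.rangeRestrict) :=
      isCompactOperator_of_locallyCompactSpace_dom L.rangeRestrict
    exact h1.clm_comp L.range.subtypeL
  let b := Module.Basis.ofVectorSpace ℂ L.range
  have hinf : Infinite (Module.Basis.ofVectorSpaceIndex ℂ L.range) := by
    by_contra h
    rw [not_infinite_iff_finite] at h
    exact hfin (Module.Finite.of_basis b)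
  let g : ℕ → Ell2 := fun n => b (Infinite.natEmbedding _ n)
  have hg : LinearIndependent ℂ g :=
    (b.linearIndependent.comp _ (Infinite.natEmbedding _).injective).map' L.range.subtype
      (Submodule.ker_subtype _)
  have hmem : ∀ k, ∃ x, L x = InnerProductSpace.gramSchmidtNormed ℂ g k := fun k => by
    change _ ∈ L.range
    have h1 : Submodule.span ℂ (Set.range g) ≤ L.range :=
      Submodule.span_le.2 (by rintro _ ⟨n, rfl⟩; exact (b _).2)
    refine h1 ?_
    rw [← InnerProductSpace.span_gramSchmidt, ← InnerProductSpace.span_gramSchmidtNormed_range]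
    exact Submodule.subset_span ⟨k, rfl⟩
  choose f hf using hmem
  exact ⟨f, by simpa only [hf] using InnerProductSpace.gramSchmidtNormed_orthonormal hg⟩

/-! ### Multipliers -/

section Multiplier

variable {B : Type*} [NonUnitalCStarAlgebra B]

theorem mul_coeHom (m : 𝓜(ℂ, B)) (b : B) :
    m * DoubleCentralizer.coeHom (𝕜 := ℂ) b = DoubleCentralizer.coeHom (𝕜 := ℂ) (m.fst b) := by
  ext z
  · exact fst_mul m b z
  · exact m.central z b

theorem coeHom_mul (m : 𝓜(ℂ, B)) (b : B) :
    DoubleCentralizer.coeHom (𝕜 := ℂ) b * m = DoubleCentralizer.coeHom (𝕜 := ℂ) (m.snd b) := by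
  ext z
  · exact (m.central b z).symm
  · exact snd_mul m z b

/-- A multiplier is determined by its left action. -/
theorem multiplier_ext_fst {m n : 𝓜(ℂ, B)} (h : ∀ b, m.fst b = n.fst b) : m = n := by
  ext z
  · exact h z
  · rw [← sub_eq_zero, ← CStarRing.mul_star_self_eq_zero_iff, sub_mul, m.central, n.central, h,
      sub_self]

/-- `B` as a closed two-sided ideal of its multiplier algebra. -/
noncomputable def coeIdeal (B : Type*) [NonUnitalCStarAlgebra B] : TwoSidedIdeal 𝓜(ℂ, B) :=
  .mk' (Set.range (DoubleCentralizer.coeHom (𝕜 := ℂ) (A := B))) ⟨0, map_zero _⟩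
    (by rintro _ _ ⟨a, rfl⟩ ⟨b, rfl⟩; exact ⟨a + b, map_add _ _ _⟩)
    (by rintro _ ⟨a, rfl⟩; exact ⟨-a, map_neg _ _⟩)
    (by rintro m _ ⟨a, rfl⟩; exact ⟨m.fst a, (mul_coeHom m a).symm⟩)
    (by rintro _ m ⟨a, rfl⟩; exact ⟨m.snd a, (coeHom_mul m a).symm⟩)

theorem coe_coeIdeal :
    (coeIdeal B : Set 𝓜(ℂ, B)) = Set.range (DoubleCentralizer.coeHom (𝕜 := ℂ) (A := B)) :=
  TwoSidedIdeal.coe_mk' ..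

theorem isClosed_coeIdeal : IsClosed (coeIdeal B : Set 𝓜(ℂ, B)) := by
  rw [coe_coeIdeal]
  exact (NonUnitalStarAlgHom.isometry _ coe_injective).isClosedEmbedding.isClosed_range

/-- A full multiplier does not lie in `B` unless `B` is unital. -/
theorem IsFull.notMem_range_coeHom {m : 𝓜(ℂ, B)} (hm : IsFull {m})
    (h1 : (1 : 𝓜(ℂ, B)) ∉ Set.range (DoubleCentralizer.coeHom (𝕜 := ℂ) (A := B))) :
    m ∉ Set.range (DoubleCentralizer.coeHom (𝕜 := ℂ) (A := B)) := fun h => h1 <| by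
  rw [← coe_coeIdeal] at h ⊢
  exact hm _ isClosed_coeIdeal (Set.singleton_subset_iff.2 h) 1

theorem isFull_singleton_of_mul_mul_eq_one {x y z : 𝓜(ℂ, B)} (h : x * y * z = 1) : IsFull {y} :=
  fun I _ hI b => by
    have hy : y ∈ I := hI rfl
    have h1 : (1 : 𝓜(ℂ, B)) ∈ I := h ▸ I.mul_mem_right _ _ (I.mul_mem_left _ _ hy)
    simpa using I.mul_mem_left b _ h1

end Multiplier

/-! ### Multipliers of the compact operators -/

/-- The multiplier of `𝕂` given by left and right multiplication with a bounded operator. -/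
noncomputable def ofOperator (L : Ell2 →L[ℂ] Ell2) : 𝓜(ℂ, 𝕂) where
  fst := LinearMap.mkContinuous
    { toFun := fun T => ⟨L * T, T.2.clm_comp L⟩
      map_add' := fun _ _ => Subtype.ext (mul_add _ _ _)
      map_smul' := fun _ _ => Subtype.ext (mul_smul_comm _ _ _) } ‖L‖
    fun T => norm_mul_le L (T : Ell2 →L[ℂ] Ell2)
  snd := LinearMap.mkContinuous
    { toFun := fun T => ⟨T * L, T.2.comp_clm L⟩
      map_add' := fun _ _ => Subtype.ext (add_mul _ _ _)
      map_smul' := fun _ _ => Subtype.ext (smul_mul_assoc _ _ _) } ‖L‖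
    fun T => (norm_mul_le (T : Ell2 →L[ℂ] Ell2) L).trans_eq (mul_comm _ _)
  central _ _ := Subtype.ext (mul_assoc _ _ _)

theorem ofOperator_fst (L : Ell2 →L[ℂ] Ell2) (T : 𝕂) :
    ((ofOperator L).fst T : Ell2 →L[ℂ] Ell2) = L * T := rfl

theorem ofOperator_one : ofOperator 1 = 1 :=
  multiplier_ext_fst fun _ => Subtype.ext (one_mul _)

theorem ofOperator_mul (L L' : Ell2 →L[ℂ] Ell2) :
    ofOperator (L * L') = ofOperator L * ofOperator L' :=
  multiplier_ext_fst fun _ => Subtype.ext (mul_assoc _ _ _)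

theorem ofOperator_sub (L L' : Ell2 →L[ℂ] Ell2) :
    ofOperator (L - L') = ofOperator L - ofOperator L' :=
  multiplier_ext_fst fun _ => Subtype.ext (sub_mul _ _ _)

theorem ofOperator_star (L : Ell2 →L[ℂ] Ell2) : ofOperator (star L) = star (ofOperator L) := by
  refine multiplier_ext_fst fun T => Subtype.ext ?_
  rw [DoubleCentralizer.star_fst, ofOperator_fst]
  change _ = star (star (T : Ell2 →L[ℂ] Ell2) * L)
  rw [star_mul, star_star]

theorem ofOperator_coe (T : 𝕂) :
    ofOperator (T : Ell2 →L[ℂ] Ell2) = DoubleCentralizer.coeHom (𝕜 := ℂ) T :=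
  multiplier_ext_fst fun _ => rfl

/-- The rank-one operator `z ↦ ⟪y, z⟫ x` as an element of `𝕂`. -/
noncomputable def ketBra (x y : Ell2) : 𝕂 :=
  ⟨InnerProductSpace.rankOne ℂ x y, isCompactOperator_rankOne x y⟩

theorem ketBra_apply_of_norm_eq_one (x : Ell2) {y : Ell2} (hy : ‖y‖ = 1) :
    (ketBra x y : Ell2 →L[ℂ] Ell2) y = x := by
  change InnerProductSpace.rankOne ℂ x y y = x
  simp [hy]

theorem mul_ketBra (T : 𝕂) (x y : Ell2) : T * ketBra x y = ketBra ((T : Ell2 →L[ℂ] Ell2) x) y :=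
  Subtype.ext (InnerProductSpace.comp_rankOne x y (T : Ell2 →L[ℂ] Ell2))

theorem ketBra_add (x x' y : Ell2) : ketBra (x + x') y = ketBra x y + ketBra x' y :=
  Subtype.ext (ContinuousLinearMap.map_add₂ _ x x' y)

theorem ketBra_smul (c : ℂ) (x y : Ell2) : ketBra (c • x) y = c • ketBra x y :=
  Subtype.ext (ContinuousLinearMap.map_smul₂ _ c x y)

theorem norm_ketBra (x y : Ell2) : ‖ketBra x y‖ = ‖x‖ * ‖y‖ :=
  InnerProductSpace.norm_rankOne x y

/-- The map `x ↦ |x⟩⟨y|` from `ℓ²(ℕ)` to `𝕂`. -/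
noncomputable def ketBraL (y : Ell2) : Ell2 →L[ℂ] 𝕂 :=
  LinearMap.mkContinuous
    { toFun := fun x => ketBra x y
      map_add' := fun x x' => ketBra_add x x' y
      map_smul' := fun c x => ketBra_smul c x y } ‖y‖
    fun x => ((norm_ketBra x y).trans (mul_comm _ _)).le

/-- Evaluation of compact operators at the vector `y`. -/
noncomputable def evalL (y : Ell2) : 𝕂 →L[ℂ] Ell2 :=
  (ContinuousLinearMap.apply ℂ Ell2 y).comp (compacts Ell2).toSubmodule.subtypeL

/-- Every multiplier `m` of `𝕂` comes from a bounded operator: with `e` a unit vector, the operator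
is `x ↦ m |x⟩⟨e| e`. -/
theorem ofOperator_surjective : Function.Surjective ofOperator := fun m => by
  have he : ‖stdBasis 0‖ = 1 := stdBasis.orthonormal.1 0
  generalize stdBasis 0 = e at he
  refine ⟨(evalL e).comp (m.fst.comp (ketBraL e)),
    multiplier_ext_fst fun T => Subtype.ext (ContinuousLinearMap.ext fun x => ?_)⟩
  calc evalL e (m.fst (ketBra ((T : Ell2 →L[ℂ] Ell2) x) e))
      = (m.fst T : Ell2 →L[ℂ] Ell2) ((ketBra x e : Ell2 →L[ℂ] Ell2) e) := by
        rw [← mul_ketBra, fst_mul]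
        rfl
    _ = _ := by rw [ketBra_apply_of_norm_eq_one x he]

/-- `𝕂` has no unit: it would be the identity operator, which is not compact. -/
theorem one_notMem_range_coeHom :
    (1 : 𝓜(ℂ, 𝕂)) ∉ Set.range (DoubleCentralizer.coeHom (𝕜 := ℂ) (A := 𝕂)) := by
  rintro ⟨T, hT⟩
  have h1 : ∀ x, (T : Ell2 →L[ℂ] Ell2) x = x := fun x => by
    have he : ‖stdBasis 0‖ = 1 := stdBasis.orthonormal.1 0
    have h2 : T * ketBra x (stdBasis 0) = ketBra x (stdBasis 0) :=
      congrArg (fun m : 𝓜(ℂ, 𝕂) => m.fst (ketBra x (stdBasis 0))) hT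
    rw [mul_ketBra] at h2
    rw [← ketBra_apply_of_norm_eq_one ((T : Ell2 →L[ℂ] Ell2) x) he, h2,
      ketBra_apply_of_norm_eq_one x he]
  have h2 : IsCompactOperator (id : Ell2 → Ell2) := by
    have h3 : IsCompactOperator (T : Ell2 →L[ℂ] Ell2) := T.2
    rwa [show ((T : Ell2 →L[ℂ] Ell2) : Ell2 → Ell2) = id from funext h1] at h3
  have := FiniteDimensional.of_isCompactOperator_id (𝕜 := ℂ) h2
  exact not_finite_iff_infinite.2 inferInstance
    (stdBasis.orthonormal.linearIndependent.finite)

/-! ### Stability and σ-unitality of `𝕂 ⊕ 𝕂` -/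

/-- The inclusion of `𝕂 ⊕ 𝕂` into the direct sum of two copies of the bounded operators. -/
noncomputable def prodIncl : 𝕂 × 𝕂 →⋆ₙₐ[ℂ] (Ell2 →L[ℂ] Ell2) × (Ell2 →L[ℂ] Ell2) where
  toFun b := (b.1, b.2)
  map_smul' _ _ := rfl
  map_zero' := rfl
  map_add' _ _ := rfl
  map_mul' _ _ := rfl
  map_star' _ := rfl

theorem isStable_prod : IsStable (𝕂 × 𝕂) := by
  refine IsStable.of_isometries prodIncl (fun a b h => ?_) (fun m b => ?_)
    (fun i => (shift i, shift i)) (fun i j => ?_) (fun b => ?_)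
  · exact Prod.ext (Subtype.ext (congrArg Prod.fst h)) (Subtype.ext (congrArg Prod.snd h))
  · exact ⟨(⟨m.1 * b.1, b.1.2.clm_comp m.1⟩, ⟨m.2 * b.2, b.2.2.clm_comp m.2⟩), rfl⟩
  · change (star (shift i) * shift j, star (shift i) * shift j) = _
    rw [star_shift_mul_shift]
    split_ifs <;> rfl
  · have h : ∀ T : 𝕂, Tendsto (fun n => (∑ i ∈ Finset.range n, shift i * star (shift i)) *
        (T : Ell2 →L[ℂ] Ell2)) atTop (𝓝 (T : Ell2 →L[ℂ] Ell2)) := fun T =>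
      tendsto_mul_of_isCompactOperator
        (fun n => (isStarProjection_sum_range_mul_star star_shift_mul_shift n).norm_le)
        tendsto_sum_shift T.2
    refine ((h b.1).prodMk_nhds (h b.2)).congr fun n => ?_
    refine Prod.ext ?_ ?_
    · simp [prodIncl, Prod.fst_sum]
    · simp [prodIncl, Prod.snd_sum]

theorem isSigmaUnital_prod : IsSigmaUnital (𝕂 × 𝕂) := by
  let u : ℕ → 𝕂 := fun n => ⟨cutoff n, isCompactOperator_cutoff n⟩
  have hu : ∀ n, star (u n) * u n = u n := fun n => Subtype.ext <| by
    change star (cutoff n) * cutoff n = cutoff n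
    rw [star_cutoff, (isStarProjection_cutoff n).isIdempotentElem]
  have hl : ∀ T : 𝕂, Tendsto (fun n => u n * T) atTop (𝓝 T) := fun T =>
    tendsto_subtype_rng.2 (tendsto_cutoff_mul T.2)
  have hr : ∀ T : 𝕂, Tendsto (fun n => T * u n) atTop (𝓝 T) := fun T =>
    tendsto_subtype_rng.2 (tendsto_mul_cutoff T.2)
  refine ⟨fun n => (u n, u n), fun n => ⟨(u n, u n), ?_⟩, fun n => ?_, fun a => ⟨?_, ?_⟩⟩
  · exact (Prod.ext (hu n) (hu n)).symm
  · exact max_le (norm_cutoff_le n) (norm_cutoff_le n)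
  · exact (hl a.1).prodMk_nhds (hl a.2)
  · exact (hr a.1).prodMk_nhds (hr a.2)

/-! ### Copies of `𝕂` cut out by isometries -/

/-- The endomorphism `T ↦ V T V⋆` of `𝕂` given by an isometry `V`. -/
noncomputable def conjIsometry {V : Ell2 →L[ℂ] Ell2} (hV : star V * V = 1) : 𝕂 →⋆ₙₐ[ℂ] 𝕂 where
  toFun T := ⟨V * T * star V, (T.2.clm_comp V).comp_clm (star V)⟩
  map_smul' _ _ := Subtype.ext <| by
    simp
  map_zero' := Subtype.ext <| by simp
  map_add' _ _ := Subtype.ext <| by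
    simp [mul_add, add_mul]
  map_mul' S T := Subtype.ext <| by
    change V * (S * T : Ell2 →L[ℂ] Ell2) * star V = (V * S * star V) * (V * T * star V)
    rw [show (V * S * star V) * (V * T * star V) = V * S * (star V * V) * T * star V by
      noncomm_ring, hV]
    noncomm_ring
  map_star' T := Subtype.ext <| by
    change V * star (T : Ell2 →L[ℂ] Ell2) * star V = star (V * T * star V)
    simp [mul_assoc]

theorem coe_conjIsometry {V : Ell2 →L[ℂ] Ell2} (hV : star V * V = 1) (T : 𝕂) :
    (conjIsometry hV T : Ell2 →L[ℂ] Ell2) = V * T * star V := rfl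

theorem star_mul_conjIsometry_mul {V : Ell2 →L[ℂ] Ell2} (hV : star V * V = 1) (T : 𝕂) :
    star V * (conjIsometry hV T : Ell2 →L[ℂ] Ell2) * V = T := by
  rw [coe_conjIsometry, show star V * (V * T * star V) * V = (star V * V) * T * (star V * V) by
    noncomm_ring, hV, one_mul, mul_one]

/-- For a non-compact operator `L` there is an isometry `V` that maps the basis vectors into the range
of `L`, so that `V 𝕂 V⋆` lies in the closure of `L 𝕂 L⋆`. -/
theorem exists_isometry_tendsto_conj {L : Ell2 →L[ℂ] Ell2} (hL : ¬ IsCompactOperator L) :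
    ∃ (V : Ell2 →L[ℂ] Ell2) (hV : star V * V = 1), ∀ T : 𝕂, ∃ C : ℕ → 𝕂,
      Tendsto (fun n => L * (C n : Ell2 →L[ℂ] Ell2) * star L) atTop
        (𝓝 (conjIsometry hV T : Ell2 →L[ℂ] Ell2)) := by
  obtain ⟨f, hf⟩ := exists_orthonormal_of_not_isCompactOperator hL
  refine ⟨isometryOf hf, star_isometryOf_mul_self hf, fun T => ?_⟩
  set V := isometryOf hf
  let G : ℕ → Ell2 →L[ℂ] Ell2 := fun n =>
    ∑ i ∈ Finset.range n, InnerProductSpace.rankOne ℂ (f i) (stdBasis i)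
  -- on the span of the first `n` basis vectors, `V` factors through `L`
  have hG : ∀ n, V * cutoff n = L * G n := fun n => by
    simp only [cutoff, G, Finset.mul_sum, ContinuousLinearMap.mul_def,
      InnerProductSpace.comp_rankOne, V, isometryOf_apply]
  refine ⟨fun n => ⟨G n * T * star (G n), (T.2.clm_comp (G n)).comp_clm (star (G n))⟩, ?_⟩
  have h : Tendsto (fun n => V * (cutoff n * T * cutoff n) * star V) atTop
      (𝓝 (V * T * star V)) :=
    ((tendsto_cutoff_mul_mul_cutoff T.2).const_mul V).mul_const (star V)
  refine h.congr fun n => ?_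
  calc V * (cutoff n * T * cutoff n) * star V = (V * cutoff n) * T * star (V * cutoff n) := by
        rw [star_mul, star_cutoff]
        noncomm_ring
    _ = L * (G n * T * star (G n)) * star L := by
        rw [hG, star_mul]
        noncomm_ring

/-- The endomorphism `(S, T) ↦ (V S V⋆, W T W⋆)` of `𝕂 ⊕ 𝕂` given by isometries `V` and `W`. -/
noncomputable def conjProd {V W : Ell2 →L[ℂ] Ell2} (hV : star V * V = 1) (hW : star W * W = 1) :
    𝕂 × 𝕂 →⋆ₙₐ[ℂ] 𝕂 × 𝕂 :=
  ((conjIsometry hV).comp (NonUnitalStarAlgHom.fst ℂ 𝕂 𝕂)).prod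
    ((conjIsometry hW).comp (NonUnitalStarAlgHom.snd ℂ 𝕂 𝕂))

theorem conjProd_injective {V W : Ell2 →L[ℂ] Ell2} (hV : star V * V = 1) (hW : star W * W = 1) :
    Function.Injective (conjProd hV hW) := by
  have h : ∀ {U : Ell2 →L[ℂ] Ell2} (hU : star U * U = 1), Function.Injective (conjIsometry hU) :=
    fun hU S T hST => Subtype.ext <| by
      rw [← star_mul_conjIsometry_mul hU S, hST, star_mul_conjIsometry_mul]
  exact fun a b hab => Prod.ext (h hV (congrArg Prod.fst hab)) (h hW (congrArg Prod.snd hab))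

/-- `V 𝕂 V⋆ ⊕ W 𝕂 W⋆` is full in `𝕂 ⊕ 𝕂`: compressing by `V⋆` and `V`, cut off to compact operators,
recovers `𝕂` in the limit. -/
theorem isFull_range_conjProd {V W : Ell2 →L[ℂ] Ell2} (hV : star V * V = 1)
    (hW : star W * W = 1) : IsFull (Set.range (conjProd hV hW)) := fun I hI hsub b => by
  let c : (Ell2 →L[ℂ] Ell2) → ℕ → 𝕂 := fun U n =>
    ⟨cutoff n * star U, (isCompactOperator_cutoff n).comp_clm (star U)⟩
  have hlim : ∀ {U : Ell2 →L[ℂ] Ell2} (hU : star U * U = 1) (T : 𝕂),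
      Tendsto (fun n => c U n * conjIsometry hU T * star (c U n)) atTop (𝓝 T) := fun {U} hU T => by
    refine tendsto_subtype_rng.2 ((tendsto_cutoff_mul_mul_cutoff T.2).congr fun n => ?_)
    change _ = cutoff n * star U * (conjIsometry hU T : Ell2 →L[ℂ] Ell2) * star (cutoff n * star U)
    rw [star_mul, star_star, star_cutoff]
    conv_lhs => rw [← star_mul_conjIsometry_mul hU T]
    noncomm_ring
  refine hI.mem_of_tendsto ((hlim hV b.1).prodMk_nhds (hlim hW b.2))
    (Eventually.of_forall fun n => ?_)
  have h1 : conjProd hV hW b ∈ I := hsub ⟨b, rfl⟩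
  exact I.mul_mem_right _ (star (c V n, c W n)) (I.mul_mem_left (c V n, c W n) _ h1)

/-! ### Multipliers of direct sums -/

section DirectSum

variable {B C : Type*} [NonUnitalCStarAlgebra B] [NonUnitalCStarAlgebra C]

theorem isStarProjection_directSum {p : 𝓜(ℂ, B)} {q : 𝓜(ℂ, C)} (hp : IsStarProjection p)
    (hq : IsStarProjection q) : IsStarProjection (directSum p q) := by
  constructor
  · refine multiplier_ext_fst fun b => Prod.ext ?_ ?_
    · exact congrArg (fun m : 𝓜(ℂ, B) => m.fst b.1) hp.isIdempotentElem
    · exact congrArg (fun m : 𝓜(ℂ, C) => m.fst b.2) hq.isIdempotentElem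
  · refine multiplier_ext_fst fun b => Prod.ext ?_ ?_
    · exact congrArg (fun m : 𝓜(ℂ, B) => m.fst b.1) hp.isSelfAdjoint
    · exact congrArg (fun m : 𝓜(ℂ, C) => m.fst b.2) hq.isSelfAdjoint

theorem smul_directSum_add_coeHom (z : ℂ) (m : 𝓜(ℂ, B)) (n : 𝓜(ℂ, C)) (b : B × C) :
    z • directSum m n + DoubleCentralizer.coeHom (𝕜 := ℂ) b =
      directSum (z • m + DoubleCentralizer.coeHom (𝕜 := ℂ) b.1)
        (z • n + DoubleCentralizer.coeHom (𝕜 := ℂ) b.2) :=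
  multiplier_ext_fst fun _ => rfl

theorem directSum_mul_coeHom_mul_star (m : 𝓜(ℂ, B)) (n : 𝓜(ℂ, C)) (b : B × C) :
    directSum m n * DoubleCentralizer.coeHom (𝕜 := ℂ) b * star (directSum m n) =
      DoubleCentralizer.coeHom (𝕜 := ℂ)
        (star (m.fst (star (m.fst b.1))), star (n.fst (star (n.fst b.2)))) := by
  rw [mul_coeHom, coeHom_mul]
  rfl

/-- The ⋆-homomorphism `z ↦ z p` from `ℂ` to `M(B)` given by a projection `p`. -/
noncomputable def smulProjection {p : 𝓜(ℂ, B)} (hp : IsStarProjection p) :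
    ℂ →⋆ₙₐ[ℂ] 𝓜(ℂ, B) where
  toFun z := z • p
  map_smul' _ _ := smul_assoc _ _ _
  map_zero' := zero_smul _ _
  map_add' _ _ := add_smul _ _ _
  map_mul' z w := by rw [smul_mul_smul_comm, hp.isIdempotentElem]
  map_star' z := by rw [star_smul, hp.isSelfAdjoint]

theorem smulProjection_one {p : 𝓜(ℂ, B)} (hp : IsStarProjection p) : smulProjection hp 1 = p :=
  one_smul ℂ p

end DirectSum

theorem mem_range_coeHom_of_smul_add {B : Type*} [NonUnitalCStarAlgebra B] {z : ℂ} (hz : z ≠ 0)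
    {m : 𝓜(ℂ, B)} {b : B} (h : z • m + DoubleCentralizer.coeHom (𝕜 := ℂ) b ∈
      Set.range (DoubleCentralizer.coeHom (𝕜 := ℂ) (A := B))) :
    m ∈ Set.range (DoubleCentralizer.coeHom (𝕜 := ℂ) (A := B)) := by
  obtain ⟨c, hc⟩ := h
  refine ⟨z⁻¹ • (c - b), ?_⟩
  rw [map_smul, map_sub, hc, add_sub_cancel_right, inv_smul_smul₀ hz]

/-! ### The trivial extension of `ℂ` by `B ⊕ C` with splitting `p ⊕ 1` -/

/-- The range of an injective endomorphism of a stable, σ-unital C⋆-algebra is a stable, σ-unital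
subalgebra. -/
theorem exists_stable_subalgebra_of_injective {B : Type*} [NonUnitalCStarAlgebra B]
    (hst : IsStable B) (hsu : IsSigmaUnital B) (ψ : B →⋆ₙₐ[ℂ] B) (hψ : Function.Injective ψ)
    (hfull : IsFull (Set.range ψ)) {S : Set B} (hS : ∀ b, ψ b ∈ S) :
    ∃ (D : NonUnitalStarSubalgebra ℂ B) (_ : IsClosed (D : Set B)),
      (D : Set B) ⊆ S ∧ IsStable D ∧ IsSigmaUnital D ∧ IsFull (D : Set B) := by
  have hrange : (NonUnitalStarAlgHom.range ψ : Set B) = Set.range ψ :=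
    NonUnitalStarAlgHom.coe_range ψ
  have hclosed : IsClosed (NonUnitalStarAlgHom.range ψ : Set B) := by
    rw [hrange]
    exact (NonUnitalStarAlgHom.isometry _ hψ).isClosedEmbedding.isClosed_range
  let f : B ≃⋆ₐ[ℂ] NonUnitalStarAlgHom.range ψ :=
    StarAlgEquiv.ofBijective (NonUnitalStarAlgHom.rangeRestrict ψ)
      ⟨fun a b hab => hψ (congrArg Subtype.val hab), fun ⟨_, b, hb⟩ => ⟨b, Subtype.ext hb⟩⟩
  refine ⟨NonUnitalStarAlgHom.range ψ, hclosed, ?_, hst.of_starAlgEquiv f, hsu.of_starAlgEquiv f,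
    hrange ▸ hfull⟩
  rw [hrange]
  rintro _ ⟨b, rfl⟩
  exact hS b

section Extension

variable {B C : Type*} [NonUnitalCStarAlgebra B] [NonUnitalCStarAlgebra C] {p : 𝓜(ℂ, B)}
  {σ : ℂ →⋆ₙₐ[ℂ] 𝓜(ℂ, B × C)}

/-- A unit of the extension algebra would force `1 - p` to lie in `B`. -/
theorem not_exists_unit_trivialAlg
    (hp : 1 - p ∉ Set.range (DoubleCentralizer.coeHom (𝕜 := ℂ) (A := B)))
    (hσ : σ 1 = directSum p 1) :
    ¬ ∃ e : trivialAlg σ, ∀ x : trivialAlg σ, e * x = x ∧ x * e = x := by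
  rintro ⟨⟨⟨z, m⟩, b, hb⟩, he⟩
  have hz : z = 1 := by
    have h := congrArg (fun x => x.1.1) (he (splitting σ 1)).1
    exact (mul_one z).symm.trans h
  -- `m` acts as a unit on the ideal `B ⊕ C`, so it is the unit of the multiplier algebra
  have hm : m = 1 := multiplier_ext_fst fun c => coe_injective <| by
    have h : m * DoubleCentralizer.coeHom (𝕜 := ℂ) c = DoubleCentralizer.coeHom (𝕜 := ℂ) c :=
      congrArg (fun x => x.1.2) (he ((trivialExtension σ).incl c)).1
    rw [← mul_coeHom, h]
    rfl
  refine hp ⟨b.1, multiplier_ext_fst fun c => ?_⟩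
  have h : DoubleCentralizer.coeHom (𝕜 := ℂ) b = 1 - directSum p 1 := by
    rw [← hσ, ← hm, ← hb, hz]
  exact congrArg (fun m : 𝓜(ℂ, B × C) => (m.fst (c, 0)).1) h

/-- The trivial extension is purely large if `p ∉ B`, `1 ∉ C` and every pair of multipliers `m ∉ B`
and `n ∉ C` admits a full copy of `B ⊕ C` in the closure of `(m ⊕ n) (B ⊕ C) (m ⊕ n)⋆`: the
multiplier part of `x ∈ E ∖ (B ⊕ C)` is `(z p + b) ⊕ (z + c)` with `z ≠ 0`. -/
theorem isPurelyLarge_trivialExtension (hst : IsStable (B × C)) (hsu : IsSigmaUnital (B × C))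
    (hp : p ∉ Set.range (DoubleCentralizer.coeHom (𝕜 := ℂ) (A := B)))
    (h1 : (1 : 𝓜(ℂ, C)) ∉ Set.range (DoubleCentralizer.coeHom (𝕜 := ℂ) (A := C)))
    (H : ∀ (m : 𝓜(ℂ, B)) (n : 𝓜(ℂ, C)),
      m ∉ Set.range (DoubleCentralizer.coeHom (𝕜 := ℂ) (A := B)) →
      n ∉ Set.range (DoubleCentralizer.coeHom (𝕜 := ℂ) (A := C)) →
      ∃ ψ : B × C →⋆ₙₐ[ℂ] B × C, Function.Injective ψ ∧ IsFull (Set.range ψ) ∧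
        ∀ b, ψ b ∈ closure {d | ∃ c : B × C, d =
          (star (m.fst (star (m.fst c.1))), star (n.fst (star (n.fst c.2))))})
    (hσ : σ 1 = directSum p 1) : (trivialExtension σ).IsPurelyLarge := by
  rintro ⟨⟨z, m⟩, b, hb⟩ hx
  have hz : z ≠ 0 := fun hz => hx (((trivialExtension σ).exact _).1 hz)
  have hm : m = directSum (z • p + DoubleCentralizer.coeHom (𝕜 := ℂ) b.1)
      (z • (1 : 𝓜(ℂ, C)) + DoubleCentralizer.coeHom (𝕜 := ℂ) b.2) := by
    rw [← smul_directSum_add_coeHom, ← hσ, ← map_smul, smul_eq_mul, mul_one, ← hb]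
    exact (add_sub_cancel _ _).symm
  obtain ⟨ψ, hψ, hfull, hmem⟩ := H _ _ (fun h => hp (mem_range_coeHom_of_smul_add hz h))
    (fun h => h1 (mem_range_coeHom_of_smul_add hz h))
  refine exists_stable_subalgebra_of_injective hst hsu ψ hψ hfull fun b' =>
    closure_mono ?_ (hmem b')
  rintro d ⟨c, hc⟩
  refine ⟨c, Subtype.ext (Prod.ext (by change (0 : ℂ) = z * 0 * star z; simp) ?_)⟩
  change DoubleCentralizer.coeHom (𝕜 := ℂ) d = m * DoubleCentralizer.coeHom (𝕜 := ℂ) c * star m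
  rw [hc, hm, directSum_mul_coeHom_mul_star]

/-- In the unitisation, `1 - (1, p ⊕ 1)` lies outside `B ⊕ C` but annihilates the summand `C`. -/
theorem not_isPurelyLarge_unitisation
    (H : ∀ S : Set (B × C), (∀ d ∈ S, d.2 = 0) → ¬ IsFull S) (hσ : σ 1 = directSum p 1) :
    ¬ (trivialExtension σ).unitisation.IsPurelyLarge := fun h => by
  let s : trivialAlg σ := splitting σ 1
  obtain ⟨D, -, hsub, -, -, hfull⟩ := h (1 - (s : Unitization ℂ (trivialAlg σ))) <| by
    rintro ⟨b, hb⟩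
    have h1 := congrArg (fun x : Unitization ℂ (trivialAlg σ) => x.fst) hb
    change (0 : ℂ) = 1 - 0 at h1
    norm_num at h1
  refine H _ (fun d hd => ?_) hfull
  refine closure_minimal (t := {d : B × C | d.2 = 0}) ?_
    (isClosed_eq continuous_snd continuous_const) (hsub hd)
  rintro d ⟨b, hb⟩
  set i := (trivialExtension σ).incl
  have h1 : i d = (i b - s * i b) - (i b - s * i b) * star s :=
    Unitization.inr_injective (R := ℂ) <| by
      change ((i d : trivialAlg σ) : Unitization ℂ (trivialAlg σ)) = _
      refine Eq.trans hb ?_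
      change (1 - (s : Unitization ℂ (trivialAlg σ))) * (i b : Unitization ℂ (trivialAlg σ)) *
        star (1 - (s : Unitization ℂ (trivialAlg σ))) = _
      simp only [Unitization.inr_sub, Unitization.inr_mul, Unitization.inr_star, star_sub, star_one]
      rw [sub_mul, one_mul, mul_sub, mul_one]
  have h2 : DoubleCentralizer.coeHom (𝕜 := ℂ) d =
      (DoubleCentralizer.coeHom (𝕜 := ℂ) b - directSum p 1 * DoubleCentralizer.coeHom (𝕜 := ℂ) b) -
      (DoubleCentralizer.coeHom (𝕜 := ℂ) b - directSum p 1 * DoubleCentralizer.coeHom (𝕜 := ℂ) b) *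
        star (directSum p 1) := by
    rw [← hσ]
    exact congrArg (fun x => x.1.2) h1
  rw [mul_coeHom, ← map_sub, coeHom_mul, ← map_sub] at h2
  rw [coe_injective h2]
  change b.2 - b.2 - star ((1 : 𝓜(ℂ, C)).fst (star (b.2 - b.2))) = 0
  simp

end Extension

/-! ### Full corners of `𝕂 ⊕ 𝕂` and full projections -/

/-- If `m` and `n` are given by operators `L` and `N`, and `V`, `W` are isometries for which `V 𝕂 V⋆`
and `W 𝕂 W⋆` can be approximated from `L 𝕂 L⋆` and `N 𝕂 N⋆`, then `V 𝕂 V⋆ ⊕ W 𝕂 W⋆` lies in the closure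
of `(m ⊕ n) (𝕂 ⊕ 𝕂) (m ⊕ n)⋆`. -/
theorem conjProd_mem_closure {m n : 𝓜(ℂ, 𝕂)} {L N V W : Ell2 →L[ℂ] Ell2}
    (hmL : ∀ T, (m.fst T : Ell2 →L[ℂ] Ell2) = L * T)
    (hnN : ∀ T, (n.fst T : Ell2 →L[ℂ] Ell2) = N * T) (hV : star V * V = 1)
    (hW : star W * W = 1)
    (hVL : ∀ T : 𝕂, ∃ C : ℕ → 𝕂, Tendsto (fun n => L * (C n : Ell2 →L[ℂ] Ell2) * star L) atTop
      (𝓝 (conjIsometry hV T : Ell2 →L[ℂ] Ell2)))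
    (hWN : ∀ T : 𝕂, ∃ C : ℕ → 𝕂, Tendsto (fun n => N * (C n : Ell2 →L[ℂ] Ell2) * star N) atTop
      (𝓝 (conjIsometry hW T : Ell2 →L[ℂ] Ell2))) (b : 𝕂 × 𝕂) :
    conjProd hV hW b ∈ closure {d | ∃ c : 𝕂 × 𝕂, d =
      (star (m.fst (star (m.fst c.1))), star (n.fst (star (n.fst c.2))))} := by
  obtain ⟨C, hC⟩ := hVL b.1
  obtain ⟨C', hC'⟩ := hWN b.2
  have h : ∀ (m : 𝓜(ℂ, 𝕂)) (L : Ell2 →L[ℂ] Ell2), (∀ T, (m.fst T : Ell2 →L[ℂ] Ell2) = L * T) →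
      ∀ T : 𝕂, (star (m.fst (star (m.fst T))) : Ell2 →L[ℂ] Ell2) = L * T * star L :=
    fun m L hmL T => by
      change star (m.fst (star (m.fst T)) : Ell2 →L[ℂ] Ell2) = _
      rw [hmL]
      change star (L * star (m.fst T : Ell2 →L[ℂ] Ell2)) = _
      rw [hmL, star_mul, star_star]
  have h1 : Tendsto (fun k => star (m.fst (star (m.fst (C k))))) atTop (𝓝 (conjIsometry hV b.1)) :=
    tendsto_subtype_rng.2 (hC.congr fun k => (h m L hmL (C k)).symm)
  have h2 : Tendsto (fun k => star (n.fst (star (n.fst (C' k))))) atTop (𝓝 (conjIsometry hW b.2)) :=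
    tendsto_subtype_rng.2 (hC'.congr fun k => (h n N hnN (C' k)).symm)
  exact mem_closure_of_tendsto (h1.prodMk_nhds h2)
    (Eventually.of_forall fun k => ⟨(C k, C' k), rfl⟩)

/-- A multiplier outside `𝕂` is left multiplication by a non-compact operator. -/
theorem exists_operator_of_notMem_range {m : 𝓜(ℂ, 𝕂)}
    (hm : m ∉ Set.range (DoubleCentralizer.coeHom (𝕜 := ℂ) (A := 𝕂))) :
    ∃ L : Ell2 →L[ℂ] Ell2, ¬ IsCompactOperator L ∧
      ∀ T, (m.fst T : Ell2 →L[ℂ] Ell2) = L * T := by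
  obtain ⟨L, hL⟩ := ofOperator_surjective m
  refine ⟨L, fun h => hm ⟨⟨L, h⟩, (ofOperator_coe ⟨L, h⟩).symm.trans hL⟩, fun T => ?_⟩
  rw [← hL]
  rfl

set_option maxHeartbeats 1000000 in
/-- If neither `m` nor `n` lies in `𝕂`, then the closure of `(m ⊕ n) (𝕂 ⊕ 𝕂) (m ⊕ n)⋆` contains a
full copy of `𝕂 ⊕ 𝕂`. -/
theorem exists_full_endomorphism (m n : 𝓜(ℂ, 𝕂))
    (hm : m ∉ Set.range (DoubleCentralizer.coeHom (𝕜 := ℂ) (A := 𝕂)))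
    (hn : n ∉ Set.range (DoubleCentralizer.coeHom (𝕜 := ℂ) (A := 𝕂))) :
    ∃ ψ : 𝕂 × 𝕂 →⋆ₙₐ[ℂ] 𝕂 × 𝕂, Function.Injective ψ ∧ IsFull (Set.range ψ) ∧
      ∀ b, ψ b ∈ closure {d | ∃ c : 𝕂 × 𝕂, d =
        (star (m.fst (star (m.fst c.1))), star (n.fst (star (n.fst c.2))))} := by
  obtain ⟨L, hL, hmL⟩ := exists_operator_of_notMem_range hm
  obtain ⟨N, hN, hnN⟩ := exists_operator_of_notMem_range hn
  obtain ⟨V, hV, hVL⟩ := exists_isometry_tendsto_conj hL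
  obtain ⟨W, hW, hWN⟩ := exists_isometry_tendsto_conj hN
  exact ⟨conjProd hV hW, conjProd_injective hV hW, isFull_range_conjProd hV hW,
    conjProd_mem_closure hmL hnN hV hW hVL hWN⟩

/-- The elements of `𝕂 ⊕ 𝕂` whose second summand is zero form a closed proper ideal. -/
theorem not_isFull_of_forall_snd_eq_zero {S : Set (𝕂 × 𝕂)} (hS : ∀ d ∈ S, d.2 = 0) :
    ¬ IsFull S := fun h => by
  let I : TwoSidedIdeal (𝕂 × 𝕂) := .mk' {d | d.2 = 0} rfl
    (fun {x y} hx hy => (congrArg₂ (· + ·) hx hy).trans (add_zero _))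
    (fun {x} hx => (congrArg (- ·) hx).trans neg_zero)
    (fun {x y} hy => (congrArg (x.2 * ·) hy).trans (mul_zero _))
    (fun {x y} hx => (congrArg (· * y.2) hx).trans (zero_mul _))
  have hI : (I : Set (𝕂 × 𝕂)) = {d | d.2 = 0} := TwoSidedIdeal.coe_mk' ..
  have hx : ‖stdBasis 0‖ = 1 := stdBasis.orthonormal.1 0
  have h0 : ((0 : 𝕂), ketBra (stdBasis 0) (stdBasis 0)) ∈ (I : Set (𝕂 × 𝕂)) :=
    h I (hI ▸ isClosed_eq continuous_snd continuous_const) (hI ▸ hS) _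
  rw [hI] at h0
  have h1 := norm_ketBra (stdBasis 0) (stdBasis 0)
  rw [show ketBra (stdBasis 0) (stdBasis 0) = 0 from h0, hx] at h1
  norm_num at h1

/-- The range projection of `shift 0` is full, and so is its complement, because compressing the
complement by the orthogonal isometry `shift 1` gives the identity. -/
theorem exists_isStarProjection_isFull :
    ∃ P : 𝓜(ℂ, 𝕂), IsStarProjection P ∧ IsFull {P} ∧ IsFull {1 - P} := by
  have h00 : star (shift 0) * shift 0 = 1 := star_shift_mul_shift 0 0
  have h11 : star (shift 1) * shift 1 = 1 := star_shift_mul_shift 1 1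
  have h10 : star (shift 1) * shift 0 = 0 := star_shift_mul_shift 1 0
  refine ⟨ofOperator (shift 0 * star (shift 0)), ⟨?_, ?_⟩, ?_, ?_⟩
  · rw [IsIdempotentElem, ← ofOperator_mul, show shift 0 * star (shift 0) *
      (shift 0 * star (shift 0)) = shift 0 * (star (shift 0) * shift 0) * star (shift 0) by
      noncomm_ring, h00, mul_one]
  · rw [isSelfAdjoint_iff, ← ofOperator_star, star_mul, star_star]
  · refine isFull_singleton_of_mul_mul_eq_one (x := ofOperator (star (shift 0)))
      (z := ofOperator (shift 0)) ?_
    rw [← ofOperator_mul, ← ofOperator_mul, show star (shift 0) * (shift 0 * star (shift 0)) *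
      shift 0 = (star (shift 0) * shift 0) * (star (shift 0) * shift 0) by noncomm_ring, h00,
      mul_one, ofOperator_one]
  · refine isFull_singleton_of_mul_mul_eq_one (x := ofOperator (star (shift 1)))
      (z := ofOperator (shift 1)) ?_
    rw [← ofOperator_one, ← ofOperator_sub, ← ofOperator_mul, ← ofOperator_mul,
      show star (shift 1) * (1 - shift 0 * star (shift 0)) * shift 1 = star (shift 1) * shift 1 -
      (star (shift 1) * shift 0) * (star (shift 0) * shift 1) by noncomm_ring, h11, h10, zero_mul,
      sub_zero]

end PurelyLargeExt

theorem mainTheorem11 :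
    -- the ideal `𝕂 ⊕ 𝕂` is stable
    PurelyLargeExt.IsStable (PurelyLargeExt.𝕂 × PurelyLargeExt.𝕂) ∧
    -- there is a full projection `P ∈ M(𝕂)` such that `1 - P` is also full
    (∃ P : 𝓜(ℂ, PurelyLargeExt.𝕂), IsStarProjection P ∧
      PurelyLargeExt.IsFull {P} ∧ PurelyLargeExt.IsFull {1 - P}) ∧
    -- for every such `P`, the trivial extension of `ℂ` by `𝕂 ⊕ 𝕂` with splitting `σ(1) = P ⊕ 1`
    -- is non-unital and purely large, but its unitisation is not purely large
    (∀ P : 𝓜(ℂ, PurelyLargeExt.𝕂), IsStarProjection P →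
      PurelyLargeExt.IsFull {P} → PurelyLargeExt.IsFull {1 - P} →
      ∃ σ : ℂ →⋆ₙₐ[ℂ] 𝓜(ℂ, PurelyLargeExt.𝕂 × PurelyLargeExt.𝕂),
        σ 1 = PurelyLargeExt.directSum P 1 ∧
        (¬ ∃ e : PurelyLargeExt.trivialAlg σ, ∀ x : PurelyLargeExt.trivialAlg σ,
          e * x = x ∧ x * e = x) ∧
        (PurelyLargeExt.trivialExtension σ).IsPurelyLarge ∧
        ¬ (PurelyLargeExt.trivialExtension σ).unitisation.IsPurelyLarge) := by
  refine ⟨PurelyLargeExt.isStable_prod, PurelyLargeExt.exists_isStarProjection_isFull,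
    fun P hP hfull hfull' => ?_⟩
  have hproj := PurelyLargeExt.isStarProjection_directSum hP (.one (R := 𝓜(ℂ, PurelyLargeExt.𝕂)))
  have h1 := PurelyLargeExt.one_notMem_range_coeHom
  have hσ : PurelyLargeExt.smulProjection hproj 1 = PurelyLargeExt.directSum P 1 :=
    PurelyLargeExt.smulProjection_one hproj
  exact ⟨_, hσ, PurelyLargeExt.not_exists_unit_trivialAlg (hfull'.notMem_range_coeHom h1) hσ,
    PurelyLargeExt.isPurelyLarge_trivialExtension PurelyLargeExt.isStable_prod
      PurelyLargeExt.isSigmaUnital_prod (hfull.notMem_range_coeHom h1) h1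
      PurelyLargeExt.exists_full_endomorphism hσ,
    PurelyLargeExt.not_isPurelyLarge_unitisation
      (fun _ => PurelyLargeExt.not_isFull_of_forall_snd_eq_zero) hσ⟩
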